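/- A C*-algebra $\mathcal A$ is called a $SAW^*$-algebra if for any two positive elements $x,y\in\mathcal A$ with $xy=0$ there is a positive element $e\in\mathcal A$ such that $ex=x$ and $ey=0$. A C*-norm on a complex $*$-algebra is a submultiplicative norm with $\|x^*x\|=\|x\|^2$ for all $x$. Theorem. Let $\mathcal A,\mathcal B,\mathcal C$ be unital commutative C*-algebras, where $\mathcal A$ is a $SAW^*$-algebra. Let $\mathcal B\otimes\mathcal C$ be the C*-algebra obtained by completing the algebraic tensor product $\mathcal B\odot\mathcal C$ over $\mathbb C$ in a C*-norm, and let $f:\mathcal A\to\mathcal B\otimes\mathcal C$ be a unital $*$-homomorphism. Then there are finitely many projections $p_1,\dots,p_s\in\mathcal B$ and finitely many projections $q_1,\dots,q_t\in\mathcal C$ with $\sum_{i=1}^s p_i=1_{\mathcal B}$ and $\sum_{j=1}^t q_j=1_{\mathcal C}$, such that for every $1\le i\le s$ and $1\le j\le t$ at least one of the following holds: (i) for every $a\in\mathcal A$, $(p_i\otimes q_j)f(a)\in (p_i\mathcal Bp_i)\otimes q_j=\{\,p_ibp_i\otimes q_j : b\in\mathcal B\,\}$; (ii) for every $a\in\mathcal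 A$, $(p_i\otimes q_j)f(a)\in p_i\otimes(q_j\mathcal Cq_j)=\{\,p_i\otimes q_jcq_j : c\in\mathcal C\,\}$. -/

import Mathlib

open scoped TensorProduct

/-- A C⋆-algebra is a SAW⋆-algebra if any two orthogonal positive elements `x`, `y` are separated
by a positive element `e` with `e * x = x` and `e * y = 0`. -/
def IsSAWStarAlgebra (A : Type*) [NonUnitalCStarAlgebra A] [PartialOrder A]
    [StarOrderedRing A] : Prop :=
  ∀ x y : A, 0 ≤ x → 0 ≤ y → x * y = 0 → ∃ e : A, 0 ≤ e ∧ e * x = x ∧ e * y = 0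

/-- A C⋆-norm on a complex ⋆-algebra `E`: a submultiplicative norm of complex algebras that
satisfies the C⋆-identity. -/
structure CStarNorm (E : Type*) [Ring E] [StarRing E] [Algebra ℂ E] extends AlgebraNorm ℂ E where
  star_mul_self' : ∀ x : E, toFun (star x * x) = toFun x ^ 2

/-- The completion of a commutative pre-C⋆-algebra is a commutative C⋆-algebra; its involution is
the continuous extension of the given one. -/
noncomputable instance UniformSpace.Completion.instCommCStarAlgebra (E : Type*) [NormedCommRing E]
    [StarRing E] [CStarRing E] [NormedAlgebra ℂ E] [StarModule ℂ E] :
    CommCStarAlgebra (UniformSpace.Completion E) where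
  __ := (inferInstance : NormedCommRing (UniformSpace.Completion E))
  __ := (inferInstance : NormedAlgebra ℂ (UniformSpace.Completion E))
  __ := (inferInstance : CompleteSpace (UniformSpace.Completion E))
  star := UniformSpace.Completion.map star
  star_involutive x := by
    have hs : UniformContinuous (star : E → E) := star_isometry.uniformContinuous
    change UniformSpace.Completion.map star (UniformSpace.Completion.map star x) = x
    induction x using UniformSpace.Completion.induction_on with
    | hp => exact isClosed_eq (UniformSpace.Completion.continuous_map.comp
        UniformSpace.Completion.continuous_map) continuous_id
    | ih x => simp [UniformSpace.Completion.map_coe hs]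
  star_mul x y := by
    have hs : UniformContinuous (star : E → E) := star_isometry.uniformContinuous
    change UniformSpace.Completion.map star (x * y) =
      UniformSpace.Completion.map star y * UniformSpace.Completion.map star x
    induction x, y using UniformSpace.Completion.induction_on₂ with
    | hp =>
      have hc := UniformSpace.Completion.continuous_map (f := (star : E → E))
      exact isClosed_eq (hc.comp continuous_mul)
        ((hc.comp continuous_snd).mul (hc.comp continuous_fst))
    | ih x y =>
      rw [← UniformSpace.Completion.coe_mul]
      simp only [UniformSpace.Completion.map_coe hs]
      rw [← UniformSpace.Completion.coe_mul, star_mul]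
  star_add x y := by
    have hs : UniformContinuous (star : E → E) := star_isometry.uniformContinuous
    change UniformSpace.Completion.map star (x + y) =
      UniformSpace.Completion.map star x + UniformSpace.Completion.map star y
    induction x, y using UniformSpace.Completion.induction_on₂ with
    | hp =>
      have hc := UniformSpace.Completion.continuous_map (f := (star : E → E))
      exact isClosed_eq (hc.comp continuous_add)
        ((hc.comp continuous_fst).add (hc.comp continuous_snd))
    | ih x y =>
      rw [← UniformSpace.Completion.coe_add]
      simp only [UniformSpace.Completion.map_coe hs]
      rw [← UniformSpace.Completion.coe_add, star_add]
  norm_mul_self_le x := by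
    have hs : UniformContinuous (star : E → E) := star_isometry.uniformContinuous
    change ‖x‖ * ‖x‖ ≤ ‖UniformSpace.Completion.map star x * x‖
    induction x using UniformSpace.Completion.induction_on with
    | hp =>
      have hc := UniformSpace.Completion.continuous_map (f := (star : E → E))
      exact isClosed_le (continuous_norm.mul continuous_norm)
        (continuous_norm.comp (hc.mul continuous_id))
    | ih x =>
      rw [UniformSpace.Completion.map_coe hs, ← UniformSpace.Completion.coe_mul,
        UniformSpace.Completion.norm_coe, UniformSpace.Completion.norm_coe,
        CStarRing.norm_star_mul_self]
  star_smul c x := by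
    have hs : UniformContinuous (star : E → E) := star_isometry.uniformContinuous
    change UniformSpace.Completion.map star (c • x) =
      star c • UniformSpace.Completion.map star x
    induction x using UniformSpace.Completion.induction_on with
    | hp =>
      have hc := UniformSpace.Completion.continuous_map (f := (star : E → E))
      exact isClosed_eq (hc.comp (continuous_const_smul c)) (hc.const_smul (star c))
    | ih x =>
      rw [← UniformSpace.Completion.coe_smul]
      simp only [UniformSpace.Completion.map_coe hs]
      rw [← UniformSpace.Completion.coe_smul, star_smul]

namespace CStarNorm

variable {E : Type*} [CommRing E] [StarRing E] [Algebra ℂ E]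

/-- A copy of the ⋆-algebra `E`, to be equipped with the C⋆-norm `ν`. -/
def Carrier (_ν : CStarNorm E) : Type _ := E

noncomputable instance (ν : CStarNorm E) : NormedCommRing ν.Carrier where
  __ := ν.toAlgebraNorm.toRingNorm.toNormedRing
  mul_comm := mul_comm (G := E)

noncomputable instance (ν : CStarNorm E) : StarRing ν.Carrier :=
  inferInstanceAs (StarRing E)

noncomputable instance (ν : CStarNorm E) : NormedAlgebra ℂ ν.Carrier where
  __ := (inferInstance : Algebra ℂ E)
  norm_smul_le c x := (ν.toAlgebraNorm.smul' c x).le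

instance (ν : CStarNorm E) : CStarRing ν.Carrier where
  norm_mul_self_le x := ((ν.star_mul_self' x).trans (sq _)).ge

/-- The C⋆-algebra obtained by completing the ⋆-algebra `E` in the C⋆-norm `ν`. -/
abbrev Completion (ν : CStarNorm E) [StarModule ℂ E] : Type _ :=
  UniformSpace.Completion ν.Carrier

variable [StarModule ℂ E]

instance (ν : CStarNorm E) : StarModule ℂ ν.Carrier :=
  inferInstanceAs (StarModule ℂ E)

/-- The canonical unital ⋆-homomorphism of `E` into its completion. -/
noncomputable def toCompletion (ν : CStarNorm E) : E →⋆ₐ[ℂ] ν.Completion where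
  toFun x := ((show ν.Carrier from x : ν.Carrier) : UniformSpace.Completion ν.Carrier)
  map_one' := UniformSpace.Completion.coe_one ν.Carrier
  map_mul' x y := UniformSpace.Completion.coe_mul (α := ν.Carrier) x y
  map_zero' := UniformSpace.Completion.coe_zero (α := ν.Carrier)
  map_add' x y := UniformSpace.Completion.coe_add (α := ν.Carrier) x y
  commutes' _ := rfl
  map_star' x := (UniformSpace.Completion.map_coe
    (f := (star : ν.Carrier → ν.Carrier)) star_isometry.uniformContinuous x).symm

end CStarNorm

open Filter Topology Set

/-! ### Cozero sets and F-spaces -/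

/-! By Gelfand duality `f` is a continuous map from the character space of the completion to `Z`,
the character space of `A`. The former is the product `X × Y` of the character spaces of `B` and
`C`, whatever the C⋆-norm: if restriction of characters missed an open box, bump functions on its
sides would give a nonzero elementary tensor killed by all characters. The SAW⋆ condition makes `Z`
an F-space.

The core is `IsFSpace.eventually_eq_or`: near each point a continuous `X × Y → Z` depends on one
coordinate at most. Given sequences `x n`, `y n`, a limit along a free ultrafilter yields one point
of `Z` in the closures of the diagonal, upper and lower values `f (x i, y j)`. If local dependence
fails, sequences can be chosen so that two of these families, or two families drawn from even and
odd indices, lie in disjoint countable unions of cozero sets; an F-space forbids a common closure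
point.

To globalise, the points where dependence on the first coordinate persists form a closed set that is
a union of connected components in the second direction, and symmetrically. The two sets are
disjoint, so a product of components meets at most one of them. Passing to the totally disconnected
component spaces gives clopen rectangles; compactness and finite clopen partitions turn these into
projections. -/

/-- A cozero set is the set where some continuous real function does not vanish. -/
def IsCozero {Z : Type*} [TopologicalSpace Z] (S : Set Z) : Prop :=
  ∃ g : C(Z, ℝ), S = Function.support g

/-- In an F-space disjoint cozero sets have disjoint closures. -/
def IsFSpace (Z : Type*) [TopologicalSpace Z] : Prop :=
  ∀ S T : Set Z, IsCozero S → IsCozero T → Disjoint S T → Disjoint (closure S) (closure T)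

namespace IsCozero

variable {Z : Type*} [TopologicalSpace Z]

theorem isOpen {S : Set Z} (h : IsCozero S) : IsOpen S := by
  obtain ⟨g, rfl⟩ := h
  exact isOpen_ne_fun g.continuous continuous_const

theorem univ : IsCozero (univ : Set Z) := ⟨1, by ext; simp⟩

theorem empty : IsCozero (∅ : Set Z) := ⟨0, by simp⟩

theorem inter {S T : Set Z} (hS : IsCozero S) (hT : IsCozero T) : IsCozero (S ∩ T) := by
  obtain ⟨g, rfl⟩ := hS
  obtain ⟨h, rfl⟩ := hT
  exact ⟨g * h, by ext; simp⟩

theorem biInter_lt {S : ℕ → Set Z} (hS : ∀ n, IsCozero (S n)) (n : ℕ) :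
    IsCozero (⋂ m < n, S m) := by
  induction n with
  | zero => simpa using univ
  | succ n ih =>
    rw [Set.biInter_lt_succ]
    exact ih.inter (hS n)

theorem iUnion {S : ℕ → Set Z} (hS : ∀ n, IsCozero (S n)) : IsCozero (⋃ n, S n) := by
  choose g hg using hS
  -- Truncation at 1 and geometric weights make the series converge uniformly without changing where
  -- its terms vanish.
  have hb : ∀ n z, ‖(1 / 2 : ℝ) ^ n * min |g n z| 1‖ ≤ (1 / 2 : ℝ) ^ n := fun n z => by
    rw [Real.norm_of_nonneg (by positivity)]
    exact mul_le_of_le_one_right (by positivity) (min_le_right _ _)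
  have hs : Summable fun n : ℕ => (1 / 2 : ℝ) ^ n :=
    summable_geometric_of_lt_one (by norm_num) (by norm_num)
  refine ⟨⟨fun z => ∑' n, (1 / 2 : ℝ) ^ n * min |g n z| 1,
    continuous_tsum (fun n => by fun_prop) hs hb⟩, ?_⟩
  ext z
  have hz : Summable fun n => (1 / 2 : ℝ) ^ n * min |g n z| 1 :=
    Summable.of_norm_bounded hs fun n => hb n z
  have h0 : ∀ n, 0 ≤ (1 / 2 : ℝ) ^ n * min |g n z| 1 := fun n => by positivity
  simp only [hg, mem_iUnion, Function.mem_support, ContinuousMap.coe_mk, ne_eq]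
  rw [← not_iff_not, not_not, ← hz.hasSum_iff, hasSum_zero_iff_of_nonneg h0, funext_iff, not_exists]
  refine forall_congr' fun n => ?_
  rw [not_not, Pi.zero_apply, mul_eq_zero, or_iff_right (by positivity)]
  constructor
  · intro h
    simp [h]
  · intro h
    by_contra h'
    have : 0 < min |g n z| 1 := lt_min (abs_pos.2 h') one_pos
    exact this.ne' h

theorem union {S T : Set Z} (hS : IsCozero S) (hT : IsCozero T) : IsCozero (S ∪ T) := by
  obtain ⟨g, rfl⟩ := hS
  obtain ⟨h, rfl⟩ := hT
  refine ⟨⟨fun z => |g z| + |h z|, by fun_prop⟩, ?_⟩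
  ext z
  simp only [mem_union, Function.mem_support, ContinuousMap.coe_mk, ne_eq]
  rw [add_eq_zero_iff_of_nonneg (abs_nonneg _) (abs_nonneg _), abs_eq_zero, abs_eq_zero]
  tauto

theorem exists_separated [CompactSpace Z] [T2Space Z] {c z : Z} (h : c ≠ z) :
    ∃ G N : Set Z, IsCozero G ∧ IsCozero N ∧ c ∈ G ∧ z ∈ N ∧ Disjoint G N := by
  obtain ⟨g, h0, h1, -⟩ := exists_continuous_zero_one_of_isClosed (isClosed_singleton (x := c))
    (isClosed_singleton (x := z)) (by simpa using h)
  refine ⟨_, _, ⟨⟨fun w => max (1 / 2 - g w) 0, by fun_prop⟩, rfl⟩,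
    ⟨⟨fun w => max (g w - 1 / 2) 0, by fun_prop⟩, rfl⟩, ?_, ?_, ?_⟩
  · simp [h0 rfl]
  · simp [h1 rfl]
    norm_num
  · rw [Set.disjoint_left]
    intro w hw hw'
    simp only [Function.mem_support, ContinuousMap.coe_mk, ne_eq, max_eq_right_iff, not_le] at hw hw'
    linarith

theorem exists_separated_finset [CompactSpace Z] [T2Space Z] (Q : Finset Z) {z : Z}
    (h : z ∉ Q) : ∃ G N : Set Z, IsCozero G ∧ IsCozero N ∧ (Q : Set Z) ⊆ G ∧ z ∈ N ∧
      Disjoint G N := by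
  classical
  induction Q using Finset.induction with
  | empty => exact ⟨∅, _, empty, univ, by simp, mem_univ z, by simp⟩
  | insert c Q hc ih =>
    obtain ⟨G, N, hG, hN, hQ, hz, hd⟩ := ih fun hz => h (Finset.mem_insert_of_mem hz)
    obtain ⟨G', N', hG', hN', hc', hz', hd'⟩ :=
      exists_separated (c := c) (z := z) fun e => h (e ▸ Finset.mem_insert_self _ _)
    refine ⟨G' ∪ G, N' ∩ N, hG'.union hG, hN'.inter hN, ?_, ⟨hz', hz⟩, ?_⟩
    · rw [Finset.coe_insert, Set.insert_subset_iff]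
      exact ⟨Or.inl hc', hQ.trans subset_union_right⟩
    · rw [Set.disjoint_left] at *
      rintro w (hw | hw) ⟨h1, h2⟩
      exacts [hd' hw h1, hd hw h2]

end IsCozero

theorem IsFSpace.disjoint_closure_iUnion {Z : Type*} [TopologicalSpace Z] (hZ : IsFSpace Z)
    {E F : ℕ → Set Z} (hE : ∀ n, IsCozero (E n)) (hF : ∀ n, IsCozero (F n))
    (h : ∀ i j, Disjoint (E i) (F j)) : Disjoint (closure (⋃ i, E i)) (closure (⋃ j, F j)) :=
  hZ _ _ (.iUnion hE) (.iUnion hF) (disjoint_iUnion_left.2 fun i => disjoint_iUnion_right.2 (h i))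

/-- Trimming a sequence of cozero sets `G n` by sets `N m` disjoint from them. -/
theorem disjoint_inter_biInter_lt {Z : Type*} {G G' N : ℕ → Set Z}
    (h : ∀ n, Disjoint (G n) (N n)) (h' : ∀ n, Disjoint (G' n) (N n)) {i j : ℕ} (hij : i ≠ j) :
    Disjoint (G i ∩ ⋂ m < i, N m) (G' j ∩ ⋂ m < j, N m) := by
  rw [Set.disjoint_left]
  rintro w ⟨h1, h2⟩ ⟨h3, h4⟩
  simp only [mem_iInter] at h2 h4
  -- The set with the larger index lies inside `N` of the smaller index, which the other set avoids.
  rcases hij.lt_or_gt with hij | hij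
  · exact Set.disjoint_left.1 (h i) h1 (h4 i hij)
  · exact Set.disjoint_left.1 (h' j) h3 (h2 j hij)

/-! ### Double limits along sequences in a product of compact spaces -/

section Local

variable {X Y Z : Type*} [TopologicalSpace X] [TopologicalSpace Y] [TopologicalSpace Z]
  [CompactSpace X] [CompactSpace Y] {f : X × Y → Z}

/-- The common point is `f (a, b)`, with `a` and `b` the limits of the two sequences along a free
ultrafilter. It is a diagonal limit and also both iterated limits; letting `j` or `i` tend to
infinity first keeps the indices in the upper or lower triangle. -/
theorem exists_mem_closure_diag_upper_lower (hf : Continuous f) (x : ℕ → X) (y : ℕ → Y) :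
    ∃ w, w ∈ closure (range fun n => f (x n, y n)) ∧
      w ∈ closure {v | ∃ i j, i < j ∧ f (x i, y j) = v} ∧
      w ∈ closure {v | ∃ i j, j < i ∧ f (x i, y j) = v} := by
  let u : Ultrafilter ℕ := hyperfilter ℕ
  have hx : Tendsto x u (𝓝 (u.map x).lim) := (u.map x).le_nhds_lim
  have hy : Tendsto y u (𝓝 (u.map y).lim) := (u.map y).le_nhds_lim
  generalize (u.map x).lim = a at hx
  generalize (u.map y).lim = b at hy
  have hu : ∀ n, ∀ᶠ m in (u : Filter ℕ), n < m := fun n =>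
    Nat.hyperfilter_le_atTop (eventually_gt_atTop n)
  refine ⟨f (a, b), ?_, ?_, ?_⟩
  · exact mem_closure_of_tendsto ((hf.tendsto _).comp (hx.prodMk_nhds hy))
      (Eventually.of_forall fun n => mem_range_self n)
  · refine isClosed_closure.mem_of_tendsto ((hf.tendsto _).comp
      (hx.prodMk_nhds (tendsto_const_nhds (x := b)))) (Eventually.of_forall fun i => ?_)
    exact mem_closure_of_tendsto ((hf.tendsto _).comp
      ((tendsto_const_nhds (x := x i)).prodMk_nhds hy)) ((hu i).mono fun j hj => ⟨i, j, hj, rfl⟩)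
  · refine isClosed_closure.mem_of_tendsto ((hf.tendsto _).comp
      ((tendsto_const_nhds (x := a)).prodMk_nhds hy)) (Eventually.of_forall fun j => ?_)
    exact mem_closure_of_tendsto ((hf.tendsto _).comp
      (hx.prodMk_nhds (tendsto_const_nhds (x := y j)))) ((hu j).mono fun i hi => ⟨i, j, hi, rfl⟩)

end Local

theorem exists_seq_mem_nhds {X Y : Type*} [TopologicalSpace X] [TopologicalSpace Y]
    {x₀ : X} {y₀ : Y} {P : X × Y → Prop} (hP : ∃ᶠ p in 𝓝 (x₀, y₀), P p)
    {U : X × Y → Set X} {V : X × Y → Set Y} (hU : ∀ p, P p → U p ∈ 𝓝 x₀)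
    (hV : ∀ p, P p → V p ∈ 𝓝 y₀) :
    ∃ p : ℕ → X × Y, (∀ n, P (p n)) ∧
      ∀ m n, m < n → (p n).1 ∈ U (p m) ∧ (p n).2 ∈ V (p m) := by
  refine exists_seq_of_forall_finset_exists P (fun p q => q.1 ∈ U p ∧ q.2 ∈ V p) fun s hs => ?_
  refine (hP.and_eventually ((eventually_all_finset s).2 fun p hp => ?_)).exists
  exact prod_mem_nhds (hU p (hs p hp)) (hV p (hs p hp))

/-! ### Local dependence on one coordinate for maps into F-spaces -/

section Local

variable {X Y Z : Type*} [TopologicalSpace X] [TopologicalSpace Y] [TopologicalSpace Z]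
  [CompactSpace X] [CompactSpace Y] [CompactSpace Z] [T2Space Z] {f : X × Y → Z}

theorem Continuous.exists_nhds_box {X Y Z : Type*} [TopologicalSpace X] [TopologicalSpace Y]
    [TopologicalSpace Z] {f : X × Y → Z} (hf : Continuous f) {x₀ : X} {y₀ : Y} {N : Set Z}
    (hN : IsOpen N) (h : f (x₀, y₀) ∈ N) :
    ∃ U ∈ 𝓝 x₀, ∃ V ∈ 𝓝 y₀, ∀ x ∈ U, ∀ y ∈ V, f (x, y) ∈ N := by
  obtain ⟨U, hU, V, hV, h⟩ := mem_nhds_prod_iff.1 (hf.continuousAt.preimage_mem_nhds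
    (hN.mem_nhds h))
  exact ⟨U, hU, V, hV, fun x hx y hy => h (mk_mem_prod hx hy)⟩

theorem Continuous.eventually_left_mem {X Y Z : Type*} [TopologicalSpace X] [TopologicalSpace Y]
    [TopologicalSpace Z] {f : X × Y → Z} (hf : Continuous f) {x₀ : X} {y : Y} {N : Set Z}
    (hN : IsOpen N) (h : f (x₀, y) ∈ N) : {x | f (x, y) ∈ N} ∈ 𝓝 x₀ :=
  (hN.preimage (hf.comp (by fun_prop : Continuous fun x => (x, y)))).mem_nhds h

theorem Continuous.eventually_right_mem {X Y Z : Type*} [TopologicalSpace X] [TopologicalSpace Y]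
    [TopologicalSpace Z] {f : X × Y → Z} (hf : Continuous f) {x : X} {y₀ : Y} {N : Set Z}
    (hN : IsOpen N) (h : f (x, y₀) ∈ N) : {y | f (x, y) ∈ N} ∈ 𝓝 y₀ :=
  (hN.preimage (hf.comp (by fun_prop : Continuous fun y => (x, y)))).mem_nhds h

/-- A continuous map into an F-space does not vary along both axes near a point. -/
theorem IsFSpace.not_frequently_axes (hZ : IsFSpace Z) (hf : Continuous f) (x₀ : X) (y₀ : Y) :
    ¬ ∃ᶠ p in 𝓝 (x₀, y₀), f (p.1, y₀) ≠ f (x₀, y₀) ∧ f (x₀, p.2) ≠ f (x₀, y₀) := by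
  intro hP
  have key : ∀ p : X × Y, ∃ (G G' N : Set Z) (U : Set X) (V : Set Y),
      (f (p.1, y₀) ≠ f (x₀, y₀) ∧ f (x₀, p.2) ≠ f (x₀, y₀)) →
      IsCozero G ∧ IsCozero G' ∧ IsCozero N ∧ Disjoint G N ∧ Disjoint G' N ∧ U ∈ 𝓝 x₀ ∧
      V ∈ 𝓝 y₀ ∧ (∀ x ∈ U, ∀ y ∈ V, f (x, y) ∈ N) ∧ (∀ y ∈ V, f (p.1, y) ∈ G) ∧
      ∀ x ∈ U, f (x, p.2) ∈ G' := by
    intro p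
    -- The empty sets in the excluded case are dummies that let `choose` produce total functions of
    -- `p`.
    by_cases hp : f (p.1, y₀) ≠ f (x₀, y₀) ∧ f (x₀, p.2) ≠ f (x₀, y₀)
    swap
    · exact ⟨∅, ∅, ∅, ∅, ∅, fun h => (hp h).elim⟩
    obtain ⟨G, N, hG, hN, hGp, hNz, hd⟩ := IsCozero.exists_separated hp.1
    obtain ⟨G', N', hG', hN', hGp', hNz', hd'⟩ := IsCozero.exists_separated hp.2
    obtain ⟨U, hU, V, hV, hUV⟩ := hf.exists_nhds_box (hN.inter hN').isOpen ⟨hNz, hNz'⟩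
    exact ⟨G, G', N ∩ N', _, _, fun _ => ⟨hG, hG', hN.inter hN', hd.mono_right inter_subset_left,
      hd'.mono_right inter_subset_right,
      inter_mem hU (hf.eventually_left_mem hG'.isOpen hGp'),
      inter_mem hV (hf.eventually_right_mem hG.isOpen hGp),
      fun x hx y hy => hUV x hx.1 y hy.1, fun y hy => hy.2, fun x hx => hx.2⟩⟩
  choose G G' N U V key using key
  obtain ⟨p, hp, hr⟩ := exists_seq_mem_nhds hP (fun p hp => (key p hp).2.2.2.2.2.1)
    (fun p hp => (key p hp).2.2.2.2.2.2.1)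
  have key := fun n => key (p n) (hp n)
  -- First coordinates come from even stages and second ones from odd stages, because `G` and `G'`
  -- of the same stage need not be disjoint. A mixed value falls in the set of its earlier stage:
  -- `G` in the upper triangle, `G'` in the lower.
  obtain ⟨w, -, hu, hl⟩ := exists_mem_closure_diag_upper_lower hf
    (fun n => (p (2 * n)).1) (fun n => (p (2 * n + 1)).2)
  refine Set.disjoint_left.1 (hZ.disjoint_closure_iUnion
    (E := fun i => G (p (2 * i)) ∩ ⋂ m < 2 * i, N (p m))
    (F := fun j => G' (p (2 * j + 1)) ∩ ⋂ m < 2 * j + 1, N (p m))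
    (fun i => (key _).1.inter (.biInter_lt (fun m => (key m).2.2.1) _))
    (fun j => (key _).2.1.inter (.biInter_lt (fun m => (key m).2.2.1) _)) fun i j =>
      disjoint_inter_biInter_lt (G := fun n => G (p n)) (G' := fun n => G' (p n))
        (N := fun n => N (p n)) (fun n => (key n).2.2.2.1) (fun n => (key n).2.2.2.2.1)
        (by omega))
    (closure_mono ?_ hu) (closure_mono ?_ hl)
  · rintro _ ⟨i, j, hij, rfl⟩
    refine mem_iUnion.2 ⟨i, (key _).2.2.2.2.2.2.2.2.1 _ (hr _ _ (by omega)).2, ?_⟩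
    exact mem_iInter₂.2 fun m hm => (key m).2.2.2.2.2.2.2.1 _ (hr _ _ hm).1 _
      (hr _ _ (by omega)).2
  · rintro _ ⟨i, j, hij, rfl⟩
    refine mem_iUnion.2 ⟨j, (key _).2.2.2.2.2.2.2.2.2 _ (hr _ _ (by omega)).1, ?_⟩
    exact mem_iInter₂.2 fun m hm => (key m).2.2.2.2.2.2.2.1 _ (hr _ _ (by omega)).1 _
      (hr _ _ hm).2

/-- Diagonal values lie in the sets `G`, lower values, being close to `f (x₀, y j)`, in the sets
`G'`. The third inequality separates `G` from `G'` at equal indices. -/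
theorem IsFSpace.not_frequently_three_values (hZ : IsFSpace Z) (hf : Continuous f)
    (x₀ : X) (y₀ : Y) : ¬ ∃ᶠ p in 𝓝 (x₀, y₀), f p ≠ f (x₀, y₀) ∧ f (x₀, p.2) ≠ f (x₀, y₀) ∧
      f p ≠ f (x₀, p.2) := by
  intro hP
  have key : ∀ p : X × Y, ∃ (G G' N : Set Z) (U : Set X) (V : Set Y),
      (f p ≠ f (x₀, y₀) ∧ f (x₀, p.2) ≠ f (x₀, y₀) ∧ f p ≠ f (x₀, p.2)) →
      IsCozero G ∧ IsCozero G' ∧ IsCozero N ∧ Disjoint G N ∧ Disjoint G' N ∧ Disjoint G G' ∧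
      U ∈ 𝓝 x₀ ∧ V ∈ 𝓝 y₀ ∧ (∀ x ∈ U, ∀ y ∈ V, f (x, y) ∈ N) ∧ f p ∈ G ∧
      ∀ x ∈ U, f (x, p.2) ∈ G' := by
    intro p
    by_cases hp : f p ≠ f (x₀, y₀) ∧ f (x₀, p.2) ≠ f (x₀, y₀) ∧ f p ≠ f (x₀, p.2)
    swap
    · exact ⟨∅, ∅, ∅, ∅, ∅, fun h => (hp h).elim⟩
    obtain ⟨G, N, hG, hN, hGp, hNz, hd⟩ := IsCozero.exists_separated hp.1
    obtain ⟨G', N', hG', hN', hGp', hNz', hd'⟩ := IsCozero.exists_separated hp.2.1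
    obtain ⟨H, H', hH, hH', hHp, hHp', hdH⟩ := IsCozero.exists_separated hp.2.2
    obtain ⟨U, hU, V, hV, hUV⟩ := hf.exists_nhds_box (hN.inter hN').isOpen ⟨hNz, hNz'⟩
    exact ⟨G ∩ H, G' ∩ H', N ∩ N', _, _, fun _ => ⟨hG.inter hH, hG'.inter hH', hN.inter hN',
      hd.mono inter_subset_left inter_subset_left, hd'.mono inter_subset_left inter_subset_right,
      hdH.mono inter_subset_right inter_subset_right,
      inter_mem hU (hf.eventually_left_mem (hG'.inter hH').isOpen ⟨hGp', hHp'⟩), hV,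
      fun x hx y hy => hUV x hx.1 y hy, ⟨hGp, hHp⟩, fun x hx => hx.2⟩⟩
  choose G G' N U V key using key
  obtain ⟨p, hp, hr⟩ := exists_seq_mem_nhds hP (fun p hp => (key p hp).2.2.2.2.2.2.1)
    (fun p hp => (key p hp).2.2.2.2.2.2.2.1)
  have key := fun n => key (p n) (hp n)
  obtain ⟨w, hd, -, hl⟩ := exists_mem_closure_diag_upper_lower hf
    (fun n => (p n).1) (fun n => (p n).2)
  refine Set.disjoint_left.1 (hZ.disjoint_closure_iUnion
    (E := fun i => G (p i) ∩ ⋂ m < i, N (p m)) (F := fun j => G' (p j) ∩ ⋂ m < j, N (p m))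
    (fun i => (key _).1.inter (.biInter_lt (fun m => (key m).2.2.1) _))
    (fun j => (key _).2.1.inter (.biInter_lt (fun m => (key m).2.2.1) _)) fun i j => ?_)
    (closure_mono ?_ hd) (closure_mono ?_ hl)
  · rcases eq_or_ne i j with rfl | hij
    · exact (key i).2.2.2.2.2.1.mono inter_subset_left inter_subset_left
    · exact disjoint_inter_biInter_lt (G := fun n => G (p n)) (G' := fun n => G' (p n))
        (N := fun n => N (p n)) (fun n => (key n).2.2.2.1) (fun n => (key n).2.2.2.2.1) hij
  · rintro _ ⟨i, rfl⟩
    refine mem_iUnion.2 ⟨i, (key _).2.2.2.2.2.2.2.2.2.1, ?_⟩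
    exact mem_iInter₂.2 fun m hm => (key m).2.2.2.2.2.2.2.2.1 _ (hr _ _ hm).1 _ (hr _ _ hm).2
  · rintro _ ⟨i, j, hij, rfl⟩
    refine mem_iUnion.2 ⟨j, (key _).2.2.2.2.2.2.2.2.2.2 _ (hr _ _ (by omega)).1, ?_⟩
    exact mem_iInter₂.2 fun m hm => (key m).2.2.2.2.2.2.2.2.1 _ (hr _ _ (by omega)).1 _
      (hr _ _ hm).2

/-- The diagonal is constant, so the common closure point is `f (x₀, y₀)` itself. Along every
subsequence it is approached by lower values in the trimmed sets `G`; even and odd indices then give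
two disjoint cozero sets with this point in both closures. -/
theorem IsFSpace.not_frequently_eq_ne (hZ : IsFSpace Z) (hf : Continuous f)
    (x₀ : X) (y₀ : Y) :
    ¬ ∃ᶠ p in 𝓝 (x₀, y₀), f p = f (x₀, y₀) ∧ f (x₀, p.2) ≠ f (x₀, y₀) := by
  intro hP
  have key : ∀ p : X × Y, ∃ (G N : Set Z) (U : Set X) (V : Set Y),
      (f p = f (x₀, y₀) ∧ f (x₀, p.2) ≠ f (x₀, y₀)) →
      IsCozero G ∧ IsCozero N ∧ Disjoint G N ∧
      U ∈ 𝓝 x₀ ∧ V ∈ 𝓝 y₀ ∧ (∀ x ∈ U, ∀ y ∈ V, f (x, y) ∈ N) ∧ ∀ x ∈ U, f (x, p.2) ∈ G := by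
    intro p
    by_cases hp : f p = f (x₀, y₀) ∧ f (x₀, p.2) ≠ f (x₀, y₀)
    swap
    · exact ⟨∅, ∅, ∅, ∅, fun h => (hp h).elim⟩
    obtain ⟨G, N, hG, hN, hGp, hNz, hd⟩ := IsCozero.exists_separated hp.2
    obtain ⟨U, hU, V, hV, hUV⟩ := hf.exists_nhds_box hN.isOpen hNz
    exact ⟨G, N, _, _, fun _ => ⟨hG, hN, hd,
      inter_mem hU (hf.eventually_left_mem hG.isOpen hGp), hV,
      fun x hx y hy => hUV x hx.1 y hy, fun x hx => hx.2⟩⟩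
  choose G N U V key using key
  obtain ⟨p, hp, hr⟩ := exists_seq_mem_nhds hP (fun p hp => (key p hp).2.2.2.1)
    (fun p hp => (key p hp).2.2.2.2.1)
  have key := fun n => key (p n) (hp n)
  have main : ∀ k : ℕ → ℕ, StrictMono k →
      f (x₀, y₀) ∈ closure (⋃ n, G (p (k n)) ∩ ⋂ m < k n, N (p m)) := by
    intro k hk
    obtain ⟨w, hd, -, hl⟩ := exists_mem_closure_diag_upper_lower hf
      (fun n => (p (k n)).1) (fun n => (p (k n)).2)
    have hw : w = f (x₀, y₀) := by
      have : range (fun n => f ((p (k n)).1, (p (k n)).2)) ⊆ {f (x₀, y₀)} := by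
        rintro _ ⟨n, rfl⟩
        exact (hp (k n)).1
      simpa using closure_mono this hd
    rw [← hw]
    refine closure_mono ?_ hl
    rintro _ ⟨i, j, hij, rfl⟩
    have hij := hk hij
    refine mem_iUnion.2 ⟨j, (key _).2.2.2.2.2.2 _ (hr _ _ hij).1, ?_⟩
    exact mem_iInter₂.2 fun m hm => (key m).2.2.2.2.2.1 _ (hr _ _ (by omega)).1 _ (hr _ _ hm).2
  have hc : ∀ n, IsCozero (G (p n) ∩ ⋂ m < n, N (p m)) := fun n =>
    (key _).1.inter (.biInter_lt (fun m => (key m).2.1) _)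
  exact Set.disjoint_left.1 (hZ.disjoint_closure_iUnion (fun n => hc (2 * n))
    (fun n => hc (2 * n + 1)) fun i j => disjoint_inter_biInter_lt (G := fun n => G (p n))
      (G' := fun n => G (p n)) (N := fun n => N (p n)) (fun n => (key n).2.2.1)
      (fun n => (key n).2.2.1) (by omega))
    (main _ fun a b h => by simpa using h) (main _ fun a b h => by simpa using h)

/-- Here the upper triangle is made constant, which again pins the closure point to `f (x₀, y₀)`,
now approached by diagonal values along even and along odd indices. -/
theorem IsFSpace.false_of_upper_eq (hZ : IsFSpace Z) (hf : Continuous f) {x₀ : X} {y₀ : Y}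
    {W : Filter (X × Y)} [W.NeBot] (hW : W ≤ 𝓝 (x₀, y₀)) (hne : ∀ᶠ p in W, f p ≠ f (x₀, y₀))
    (hu : ∀ᶠ p in W, ∀ᶠ q in W, f (p.1, q.2) = f (x₀, y₀)) : False := by
  have key : ∀ c : Z, ∃ G N : Set Z, c ≠ f (x₀, y₀) →
      IsCozero G ∧ IsCozero N ∧ c ∈ G ∧ f (x₀, y₀) ∈ N ∧ Disjoint G N := by
    intro c
    by_cases hc : c = f (x₀, y₀)
    · exact ⟨∅, ∅, fun h => (h hc).elim⟩
    · obtain ⟨G, N, h⟩ := IsCozero.exists_separated hc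
      exact ⟨G, N, fun _ => h⟩
  choose G N key using key
  obtain ⟨p, hp, hr⟩ := exists_seq_of_forall_finset_exists
    (fun p : X × Y => f p ≠ f (x₀, y₀) ∧ ∀ᶠ q in W, f (p.1, q.2) = f (x₀, y₀))
    (fun p q => f q ∈ N (f p) ∧ f (p.1, q.2) = f (x₀, y₀)) (by
      intro s hs
      refine ((hne.and hu).and ((eventually_all_finset s).2 fun p hp => ?_)).exists
      refine Eventually.and ?_ (hs p hp).2
      have := key _ (hs p hp).1
      exact hW (hf.continuousAt.preimage_mem_nhds (this.2.1.isOpen.mem_nhds this.2.2.2.1)))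
  have key := fun n => key (f (p n)) (hp n).1
  have main : ∀ k : ℕ → ℕ, StrictMono k →
      f (x₀, y₀) ∈ closure (⋃ n, G (f (p (k n))) ∩ ⋂ m < k n, N (f (p m))) := by
    intro k hk
    obtain ⟨w, hd, hu, -⟩ := exists_mem_closure_diag_upper_lower hf
      (fun n => (p (k n)).1) (fun n => (p (k n)).2)
    have hw : w = f (x₀, y₀) := by
      have : {v | ∃ i j, i < j ∧ f ((p (k i)).1, (p (k j)).2) = v} ⊆ {f (x₀, y₀)} := by
        rintro _ ⟨i, j, hij, rfl⟩
        exact (hr _ _ (hk hij)).2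
      simpa using closure_mono this hu
    rw [← hw]
    refine closure_mono ?_ hd
    rintro _ ⟨n, rfl⟩
    refine mem_iUnion.2 ⟨n, (key _).2.2.1, ?_⟩
    exact mem_iInter₂.2 fun m hm => (hr _ _ hm).1
  have hc : ∀ n, IsCozero (G (f (p n)) ∩ ⋂ m < n, N (f (p m))) := fun n =>
    (key _).1.inter (.biInter_lt (fun m => (key m).2.1) _)
  exact Set.disjoint_left.1 (hZ.disjoint_closure_iUnion (fun n => hc (2 * n))
    (fun n => hc (2 * n + 1)) fun i j => disjoint_inter_biInter_lt (G := fun n => G (f (p n)))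
      (G' := fun n => G (f (p n))) (N := fun n => N (f (p n))) (fun n => (key n).2.2.2.2)
      (fun n => (key n).2.2.2.2) (by omega))
    (main _ fun a b h => by simpa using h) (main _ fun a b h => by simpa using h)

/-- A stage in the inductive choice of a sequence of points near `(x₀, y₀)`: a point together with
neighbourhoods of `x₀` and `y₀` restricting the later points and cozero sets separating the
values at mixed pairs from the value at `(x₀, y₀)`. -/
structure StageData (X Y Z : Type*) where
  pt : X × Y
  U : Set X
  V : Set Y
  G : Set Z
  N : Set Z

/-- Each mixed value is assigned to the cozero set of its later index. With even first and odd
second indices, that index is odd in the upper triangle and even in the lower, so the trimmed sets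
are disjoint. -/
theorem IsFSpace.false_of_upper_lower_ne (hZ : IsFSpace Z) (hf : Continuous f) {x₀ : X} {y₀ : Y}
    {W : Filter (X × Y)} [W.NeBot] (hW : W ≤ 𝓝 (x₀, y₀))
    (hx : ∀ᶠ p in W, f (p.1, y₀) = f (x₀, y₀)) (hy : ∀ᶠ p in W, f (x₀, p.2) = f (x₀, y₀))
    (hu : ∀ᶠ p in W, ∀ᶠ q in W, f (p.1, q.2) ≠ f (x₀, y₀))
    (hl : ∀ᶠ p in W, ∀ᶠ q in W, f (q.1, p.2) ≠ f (x₀, y₀)) : False := by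
  classical
  obtain ⟨s, hs, hr⟩ := exists_seq_of_forall_finset_exists
    (fun s : StageData X Y Z => f (s.pt.1, y₀) = f (x₀, y₀) ∧ f (x₀, s.pt.2) = f (x₀, y₀) ∧
      (∀ᶠ q in W, f (s.pt.1, q.2) ≠ f (x₀, y₀)) ∧ (∀ᶠ q in W, f (q.1, s.pt.2) ≠ f (x₀, y₀)) ∧
      IsCozero s.G ∧ IsCozero s.N ∧ Disjoint s.G s.N ∧ s.U ∈ 𝓝 x₀ ∧ s.V ∈ 𝓝 y₀ ∧
      (∀ x ∈ s.U, ∀ y ∈ s.V, f (x, y) ∈ s.N) ∧ (∀ y ∈ s.V, f (s.pt.1, y) ∈ s.N) ∧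
      ∀ x ∈ s.U, f (x, s.pt.2) ∈ s.N)
    (fun s t => t.pt.1 ∈ s.U ∧ t.pt.2 ∈ s.V ∧ f (s.pt.1, t.pt.2) ∈ t.G ∧
      f (t.pt.1, s.pt.2) ∈ t.G ∧ (∀ y ∈ t.V, f (s.pt.1, y) ∈ t.N) ∧
      ∀ x ∈ t.U, f (x, s.pt.2) ∈ t.N) (by
      intro S hS
      obtain ⟨p, ⟨⟨hpx, hpy⟩, hpu, hpl⟩, hp⟩ := ((hx.and hy).and (hu.and hl)).and
        ((eventually_all_finset S).2 fun s hs => (hS s hs).2.2.1.and ((hS s hs).2.2.2.1.and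
          (hW (prod_mem_nhds (hS s hs).2.2.2.2.2.2.2.1 (hS s hs).2.2.2.2.2.2.2.2.1)))) |>.exists
      obtain ⟨G, N, hG, hN, hQ, hz, hd⟩ := IsCozero.exists_separated_finset
        (S.image (fun s => f (s.pt.1, p.2)) ∪ S.image (fun s => f (p.1, s.pt.2)))
        (z := f (x₀, y₀)) (by
          simp only [Finset.mem_union, Finset.mem_image, not_or, not_exists, not_and]
          exact ⟨fun s hs => (hp s hs).1, fun s hs => (hp s hs).2.1⟩)
      obtain ⟨U, hU, V, hV, hUV⟩ := hf.exists_nhds_box hN.isOpen hz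
      -- The neighbourhoods also control pairings with `p` and with all earlier points, since the
      -- trimming must hold for stages below, at and above the smaller index. They exist because `f`
      -- equals `f (x₀, y₀)` along the axes at the chosen points.
      refine ⟨⟨p, {x ∈ U | f (x, p.2) ∈ N ∧ ∀ s ∈ S, f (x, s.pt.2) ∈ N},
        {y ∈ V | f (p.1, y) ∈ N ∧ ∀ s ∈ S, f (s.pt.1, y) ∈ N}, G, N⟩, ⟨hpx, hpy, hpu, hpl, hG, hN,
        hd, ?_, ?_, fun x hx y hy => hUV x hx.1 y hy.1, fun y hy => hy.2.1, fun x hx => hx.2.1⟩,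
        fun s hs => ⟨(hp s hs).2.2.1, (hp s hs).2.2.2, hQ ?_, hQ ?_,
          fun y hy => hy.2.2 s hs, fun x hx => hx.2.2 s hs⟩⟩
      · refine Eventually.and hU (Eventually.and ?_ ((eventually_all_finset S).2 fun s hs => ?_))
        · exact hf.eventually_left_mem hN.isOpen (hpy ▸ hz)
        · exact hf.eventually_left_mem hN.isOpen ((hS s hs).2.1 ▸ hz)
      · refine Eventually.and hV (Eventually.and ?_ ((eventually_all_finset S).2 fun s hs => ?_))
        · exact hf.eventually_right_mem hN.isOpen (hpx ▸ hz)
        · exact hf.eventually_right_mem hN.isOpen ((hS s hs).1 ▸ hz)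
      · exact Finset.mem_coe.2 (Finset.mem_union_left _ (Finset.mem_image_of_mem _ hs))
      · exact Finset.mem_coe.2 (Finset.mem_union_right _
          (Finset.mem_image_of_mem (fun s : StageData X Y Z => f (p.1, s.pt.2)) hs)))
  obtain ⟨w, -, hu, hl⟩ := exists_mem_closure_diag_upper_lower hf
    (fun n => (s (2 * n)).pt.1) (fun n => (s (2 * n + 1)).pt.2)
  have hc : ∀ n, IsCozero ((s n).G ∩ ⋂ m < n, (s m).N) := fun n =>
    (hs n).2.2.2.2.1.inter (.biInter_lt (fun m => (hs m).2.2.2.2.2.1) _)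
  refine Set.disjoint_left.1 (hZ.disjoint_closure_iUnion (fun n => hc (2 * n))
    (fun n => hc (2 * n + 1)) fun i j => disjoint_inter_biInter_lt (G := fun n => (s n).G)
      (G' := fun n => (s n).G) (N := fun n => (s n).N) (fun n => (hs n).2.2.2.2.2.2.1)
      (fun n => (hs n).2.2.2.2.2.2.1) (by omega)) (closure_mono ?_ hl) (closure_mono ?_ hu)
  · rintro _ ⟨i, j, hij, rfl⟩
    refine mem_iUnion.2 ⟨i, (hr (2 * j + 1) (2 * i) (by omega)).2.2.2.1,
      mem_iInter₂.2 fun m hm => ?_⟩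
    rcases lt_trichotomy m (2 * j + 1) with h | rfl | h
    · exact (hs m).2.2.2.2.2.2.2.2.2.1 _ (hr _ _ hm).1 _ (hr _ _ h).2.1
    · exact (hs _).2.2.2.2.2.2.2.2.2.2.2 _ (hr _ _ hm).1
    · exact (hr _ _ h).2.2.2.2.2 _ (hr _ _ hm).1
  · rintro _ ⟨i, j, hij, rfl⟩
    refine mem_iUnion.2 ⟨j, (hr (2 * i) (2 * j + 1) (by omega)).2.2.1,
      mem_iInter₂.2 fun m hm => ?_⟩
    rcases lt_trichotomy m (2 * i) with h | rfl | h
    · exact (hs m).2.2.2.2.2.2.2.2.2.1 _ (hr _ _ h).1 _ (hr _ _ hm).2.1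
    · exact (hs _).2.2.2.2.2.2.2.2.2.2.1 _ (hr _ _ hm).2.1
    · exact (hr _ _ h).2.2.2.2.1 _ (hr _ _ hm).2.1

/-- An ultrafilter on the bad points decides whether mixed values equal `f (x₀, y₀)`. Equality in
either triangle is handled by `false_of_upper_eq`, up to a swap; otherwise both triangles avoid the
value. -/
theorem IsFSpace.not_frequently_ne_eq (hZ : IsFSpace Z) (hf : Continuous f) {x₀ : X} {y₀ : Y}
    (hx : ∀ᶠ x in 𝓝 x₀, f (x, y₀) = f (x₀, y₀)) :
    ¬ ∃ᶠ p in 𝓝 (x₀, y₀), f p ≠ f (x₀, y₀) ∧ f (x₀, p.2) = f (x₀, y₀) := by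
  intro hP
  have := frequently_iff_neBot.1 hP
  obtain ⟨W, hW⟩ := Ultrafilter.exists_le (𝓝 (x₀, y₀) ⊓ 𝓟 {p | f p ≠ f (x₀, y₀) ∧
    f (x₀, p.2) = f (x₀, y₀)})
  have hWP : ∀ᶠ p in (W : Filter (X × Y)), f p ≠ f (x₀, y₀) ∧ f (x₀, p.2) = f (x₀, y₀) :=
    le_principal_iff.1 (hW.trans inf_le_right)
  replace hW : (W : Filter (X × Y)) ≤ 𝓝 (x₀, y₀) := hW.trans inf_le_left
  have hWx : ∀ᶠ p in (W : Filter (X × Y)), f (p.1, y₀) = f (x₀, y₀) :=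
    hW ((continuous_fst.tendsto (x₀, y₀)).eventually hx)
  by_cases hu : ∀ᶠ p in (W : Filter (X × Y)), ∀ᶠ q in (W : Filter (X × Y)),
      f (p.1, q.2) = f (x₀, y₀)
  · exact hZ.false_of_upper_eq hf hW (hWP.mono fun p hp => hp.1) hu
  by_cases hl : ∀ᶠ p in (W : Filter (X × Y)), ∀ᶠ q in (W : Filter (X × Y)),
      f (q.1, p.2) = f (x₀, y₀)
  · have hW' : map Prod.swap (W : Filter (X × Y)) ≤ 𝓝 (y₀, x₀) :=
      (map_mono hW).trans (continuous_swap.tendsto (x₀, y₀))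
    exact hZ.false_of_upper_eq (f := f ∘ Prod.swap) (hf.comp continuous_swap) hW'
      (hWP.mono fun p hp => hp.1) hl
  · rw [← Ultrafilter.eventually_not] at hu hl
    refine hZ.false_of_upper_lower_ne hf hW hWx (hWP.mono fun p hp => hp.2)
      (hu.mono fun p hp => ?_) (hl.mono fun p hp => ?_)
    · rwa [← Ultrafilter.eventually_not] at hp
    · rwa [← Ultrafilter.eventually_not] at hp

/-- If `f p` and `f (x₀, p.2)` differ, either both or exactly one of them differ from `f (x₀, y₀)`;
the three preceding exclusions cover these cases. -/
theorem IsFSpace.eventually_eq_right (hZ : IsFSpace Z) (hf : Continuous f) {x₀ : X} {y₀ : Y}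
    (hx : ∀ᶠ x in 𝓝 x₀, f (x, y₀) = f (x₀, y₀)) :
    ∀ᶠ p in 𝓝 (x₀, y₀), f p = f (x₀, p.2) := by
  have h1 := not_frequently.1 (hZ.not_frequently_three_values hf x₀ y₀)
  have h2 := not_frequently.1 (hZ.not_frequently_eq_ne hf x₀ y₀)
  have h3 := not_frequently.1 (hZ.not_frequently_ne_eq hf hx)
  filter_upwards [h1, h2, h3] with p h1 h2 h3
  by_contra h
  by_cases ha : f p = f (x₀, y₀)
  · exact h2 ⟨ha, fun hb => h (ha.trans hb.symm)⟩
  · by_cases hb : f (x₀, p.2) = f (x₀, y₀)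
    · exact h3 ⟨ha, hb⟩
    · exact h1 ⟨ha, hb, h⟩

/-- Locally, a continuous map from a product of compact spaces into an F-space depends on at most
one of the coordinates. -/
theorem IsFSpace.eventually_eq_or (hZ : IsFSpace Z) (hf : Continuous f) (x₀ : X) (y₀ : Y) :
    (∀ᶠ p in 𝓝 (x₀, y₀), f p = f (x₀, p.2)) ∨ ∀ᶠ p in 𝓝 (x₀, y₀), f p = f (p.1, y₀) := by
  by_cases hx : ∀ᶠ x in 𝓝 x₀, f (x, y₀) = f (x₀, y₀)
  · exact Or.inl (hZ.eventually_eq_right hf hx)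
  by_cases hy : ∀ᶠ y in 𝓝 y₀, f (x₀, y) = f (x₀, y₀)
  · right
    have := hZ.eventually_eq_right (f := f ∘ Prod.swap) (hf.comp continuous_swap) hy
    exact (continuous_swap.tendsto (x₀, y₀)).eventually this
  · refine (hZ.not_frequently_axes hf x₀ y₀ ?_).elim
    rw [nhds_prod_eq]
    exact frequently_prod_and.2 ⟨not_eventually.1 hx, not_eventually.1 hy⟩

end Local

/-! ### Clopen rectangles -/

section Global

variable {X Y Z : Type*} [TopologicalSpace X] [TopologicalSpace Y]

/-- The points near which `f` depends on the second coordinate only. -/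
def locallySndOnly (f : X × Y → Z) : Set (X × Y) :=
  {p | ∃ U ∈ 𝓝 p.1, ∃ V ∈ 𝓝 p.2, ∀ x ∈ U, ∀ x' ∈ U, ∀ y ∈ V, f (x, y) = f (x', y)}

theorem isOpen_locallySndOnly (f : X × Y → Z) : IsOpen (locallySndOnly f) := by
  rw [isOpen_iff_mem_nhds]
  rintro ⟨x, y⟩ ⟨U, hU, V, hV, h⟩
  refine mem_of_superset (prod_mem_nhds (eventually_mem_nhds_iff.2 hU)
    (eventually_mem_nhds_iff.2 hV)) ?_
  rintro ⟨x', y'⟩ ⟨hx', hy'⟩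
  exact ⟨U, hx', V, hy', h⟩

theorem mem_locallySndOnly_of_eventually {f : X × Y → Z} {x₀ : X} {y₀ : Y}
    (h : ∀ᶠ p in 𝓝 (x₀, y₀), f p = f (x₀, p.2)) : (x₀, y₀) ∈ locallySndOnly f := by
  obtain ⟨U, hU, V, hV, h⟩ := mem_nhds_prod_iff.1 h
  exact ⟨U, hU, V, hV, fun x hx x' hx' y hy =>
    (h (mk_mem_prod hx hy)).trans (h (mk_mem_prod hx' hy)).symm⟩

/-- If `f` locally depends on one coordinate at most, the set of points near which `f` does vary
with the first coordinate contains with a point its connected component in the second direction. -/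
theorem notMem_locallySndOnly_of_mem_connectedComponent {f : X × Y → Z}
    (hf : ∀ p : X × Y, p ∈ locallySndOnly f ∨ p.swap ∈ locallySndOnly (f ∘ Prod.swap))
    {x : X} {y y' : Y} (h : (x, y) ∉ locallySndOnly f) (hy : y' ∈ connectedComponent y) :
    (x, y') ∉ locallySndOnly f := by
  have hc : IsClopen {v | (x, v) ∉ locallySndOnly f} := by
    refine ⟨((isOpen_locallySndOnly f).preimage (by fun_prop : Continuous fun v : Y =>
      (x, v))).isClosed_compl, isOpen_iff_mem_nhds.2 fun v hv => ?_⟩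
    obtain ⟨V, hV, U, hU, hUV⟩ := (hf (x, v)).resolve_left hv
    -- On the box `f` ignores the second coordinate, so local constancy in the first coordinate at
    -- height `v'` would transfer to height `v`.
    refine mem_of_superset (eventually_mem_nhds_iff.2 hV) fun v' hv' hmem => hv ?_
    obtain ⟨U', hU', V', hV', h'⟩ := hmem
    refine ⟨U ∩ U', inter_mem hU hU', V, hV, fun a ha a' ha' b hb => ?_⟩
    have hv'V : v' ∈ V := mem_of_mem_nhds hv'
    exact (hUV b hb v' hv'V a ha.1).trans ((h' a ha.2 a' ha'.2 v' (mem_of_mem_nhds hV')).trans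
      (hUV v' hv'V b hb a' ha'.1))
  exact hc.connectedComponent_subset h hy

/-- If the product of the components of `x` and `y` met both complements, sliding one witness
vertically and the other horizontally would bring them to a common point, contradicting `hf`. The
complement it misses has closed image in the product of component spaces, where clopen rectangles
form a basis. -/
theorem exists_isClopen_prod_subset_or [CompactSpace X] [T2Space X] [CompactSpace Y] [T2Space Y]
    {f : X × Y → Z}
    (hf : ∀ p : X × Y, p ∈ locallySndOnly f ∨ p.swap ∈ locallySndOnly (f ∘ Prod.swap))
    (x : X) (y : Y) : ∃ (U : Set X) (V : Set Y), IsClopen U ∧ IsClopen V ∧ x ∈ U ∧ y ∈ V ∧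
      (U ×ˢ V ⊆ locallySndOnly f ∨ V ×ˢ U ⊆ locallySndOnly (f ∘ Prod.swap)) := by
  let π : X × Y → ConnectedComponents X × ConnectedComponents Y :=
    Prod.map (↑) (↑)
  have hπ : Continuous π :=
    ConnectedComponents.continuous_coe.prodMap ConnectedComponents.continuous_coe
  have key : ∀ K : Set (X × Y), IsClosed K → π (x, y) ∉ π '' K →
      ∃ (U : Set X) (V : Set Y), IsClopen U ∧ IsClopen V ∧ x ∈ U ∧ y ∈ V ∧ U ×ˢ V ⊆ Kᶜ := by
    intro K hK hxy
    have ho : IsOpen (π '' K)ᶜ := (hK.isCompact.image hπ).isClosed.isOpen_compl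
    obtain ⟨U, V, hU, hV, hxU, hyV, hUV⟩ := isOpen_prod_iff.1 ho _ _ hxy
    obtain ⟨U', hU', hxU', hUU'⟩ := compact_exists_isClopen_in_isOpen hU hxU
    obtain ⟨V', hV', hyV', hVV'⟩ := compact_exists_isClopen_in_isOpen hV hyV
    refine ⟨_, _, hU'.preimage ConnectedComponents.continuous_coe,
      hV'.preimage ConnectedComponents.continuous_coe, hxU', hyV', ?_⟩
    rintro ⟨a, b⟩ ⟨ha, hb⟩ hab
    exact hUV (mk_mem_prod (hUU' ha) (hVV' hb)) ⟨(a, b), hab, rfl⟩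
  by_cases h1 : π (x, y) ∈ π '' (locallySndOnly f)ᶜ
  · have hf' : ∀ p : Y × X, p ∈ locallySndOnly (f ∘ Prod.swap) ∨
        p.swap ∈ locallySndOnly ((f ∘ Prod.swap) ∘ Prod.swap) := fun p => (hf p.swap).symm
    obtain ⟨U, V, hU, hV, hx, hy, h⟩ := key
      (Prod.swap ⁻¹' (locallySndOnly (f ∘ Prod.swap)))ᶜ
      ((isOpen_locallySndOnly _).preimage continuous_swap).isClosed_compl (by
        rintro ⟨⟨a, b⟩, hab, he⟩
        obtain ⟨⟨a', b'⟩, hab', he'⟩ := h1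
        obtain ⟨he1, he2⟩ := Prod.mk.inj (he.trans he'.symm)
        rw [ConnectedComponents.coe_eq_coe'] at he1 he2
        have h1 : (a', b) ∉ locallySndOnly f :=
          notMem_locallySndOnly_of_mem_connectedComponent hf hab' he2
        have h2 : (b, a') ∉ locallySndOnly (f ∘ Prod.swap) :=
          notMem_locallySndOnly_of_mem_connectedComponent hf' hab
            (connectedComponent_eq he1 ▸ mem_connectedComponent)
        exact (hf (a', b)).elim h1 h2)
    refine ⟨U, V, hU, hV, hx, hy, Or.inr ?_⟩
    rintro ⟨b, a⟩ ⟨hb, ha⟩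
    simpa using h (mk_mem_prod ha hb)
  · obtain ⟨U, V, hU, hV, hx, hy, h⟩ := key _ (isOpen_locallySndOnly f).isClosed_compl h1
    exact ⟨U, V, hU, hV, hx, hy, Or.inl (by simpa using h)⟩

/-- Local independence of the first coordinate need not be independence on all of `U ×ˢ V`. Fixing
the slice at `x` repairs this; compactness of `V` makes the condition open. -/
theorem isClopen_inter_forall_eq [TopologicalSpace Z] [T2Space Z] [CompactSpace Y]
    {f : X × Y → Z} (hf : Continuous f) {U : Set X} {V : Set Y} (hU : IsClopen U)
    (hV : IsClopen V) (h : U ×ˢ V ⊆ locallySndOnly f) (x : X) :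
    IsClopen {x' ∈ U | ∀ y ∈ V, f (x', y) = f (x, y)} := by
  constructor
  · have : {x' ∈ U | ∀ y ∈ V, f (x', y) = f (x, y)} =
        U ∩ ⋂ y ∈ V, {x' | f (x', y) = f (x, y)} := by ext; simp
    rw [this]
    exact hU.isClosed.inter
      (isClosed_biInter fun y _ => isClosed_eq (by fun_prop) continuous_const)
  · refine isOpen_iff_mem_nhds.2 ?_
    rintro a ⟨ha, hax⟩
    have : ∀ᶠ b in 𝓝 a, ∀ y ∈ V, f (b, y) = f (a, y) := by
      refine hV.isClosed.isCompact.eventually_forall_of_forall_eventually fun y hy => ?_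
      obtain ⟨U', hU', V', hV', h'⟩ := h (mk_mem_prod ha hy)
      exact mem_of_superset (prod_mem_nhds hU' hV') fun p hp =>
        h' _ hp.1 _ (mem_of_mem_nhds hU') _ hp.2
    filter_upwards [this, hU.isOpen.mem_nhds ha] with b hb hbU
    exact ⟨hbU, fun y hy => (hb y hy).trans (hax y hy)⟩

/-- A continuous map from a product of compact Hausdorff spaces into a compact Hausdorff F-space
depends on at most one coordinate on a clopen rectangle around each point. -/
theorem IsFSpace.exists_isClopen_prod [TopologicalSpace Z] [CompactSpace X] [T2Space X]
    [CompactSpace Y] [T2Space Y] [CompactSpace Z] [T2Space Z] (hZ : IsFSpace Z) {f : X × Y → Z}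
    (hf : Continuous f) (x : X) (y : Y) :
    ∃ (U : Set X) (V : Set Y), IsClopen U ∧ IsClopen V ∧ x ∈ U ∧ y ∈ V ∧
      ((∀ a ∈ U, ∀ a' ∈ U, ∀ b ∈ V, f (a, b) = f (a', b)) ∨
        ∀ a ∈ U, ∀ b ∈ V, ∀ b' ∈ V, f (a, b) = f (a, b')) := by
  have hloc : ∀ p : X × Y, p ∈ locallySndOnly f ∨ p.swap ∈ locallySndOnly (f ∘ Prod.swap) := by
    rintro ⟨a, b⟩
    refine (hZ.eventually_eq_or hf a b).imp mem_locallySndOnly_of_eventually fun h => ?_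
    exact mem_locallySndOnly_of_eventually ((continuous_swap.tendsto (b, a)).eventually h)
  obtain ⟨U, V, hU, hV, hx, hy, h | h⟩ := exists_isClopen_prod_subset_or hloc x y
  · exact ⟨_, V, isClopen_inter_forall_eq hf hU hV h x, hV, ⟨hx, fun _ _ => rfl⟩, hy, Or.inl
      fun a ha a' ha' b hb => (ha.2 b hb).trans (ha'.2 b hb).symm⟩
  · exact ⟨U, _, hU, isClopen_inter_forall_eq (hf.comp continuous_swap) hV hU h y, hx,
      ⟨hy, fun _ _ => rfl⟩, Or.inr fun a ha b hb b' hb' => (hb.2 a ha).trans (hb'.2 a ha).symm⟩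

end Global

/-! ### Gelfand duality -/

open WeakDual

section Gelfand

variable {A : Type*} [CommCStarAlgebra A]

theorem exists_forall_characterSpace_apply_eq (F : C(characterSpace ℂ A, ℂ)) :
    ∃ a : A, ∀ χ : characterSpace ℂ A, χ a = F χ :=
  ⟨(gelfandStarTransform A).symm F,
    DFunLike.congr_fun ((gelfandStarTransform A).apply_symm_apply F)⟩

theorem eq_of_forall_characterSpace {a b : A} (h : ∀ χ : characterSpace ℂ A, χ a = χ b) :
    a = b :=
  (gelfandStarTransform A).injective (ContinuousMap.ext h)

/-- The character space of a commutative unital SAW⋆-algebra is an F-space. -/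
theorem IsSAWStarAlgebra.isFSpace [PartialOrder A] [StarOrderedRing A]
    (hA : IsSAWStarAlgebra A) : IsFSpace (characterSpace ℂ A) := by
  -- Squaring makes `g` positive without changing its cozero set.
  have key : ∀ g : C(characterSpace ℂ A, ℝ), ∃ x : A, 0 ≤ x ∧
      ∀ χ : characterSpace ℂ A, χ x = ((g χ ^ 2 : ℝ) : ℂ) := fun g => by
    obtain ⟨a, ha⟩ := exists_forall_characterSpace_apply_eq
      ⟨fun χ : characterSpace ℂ A => (g χ : ℂ), by fun_prop⟩
    refine ⟨star a * a, star_mul_self_nonneg _, fun χ => ?_⟩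
    rw [map_mul, map_star, ha]
    simp [sq]
  rintro _ _ ⟨g, rfl⟩ ⟨h, rfl⟩ hd
  obtain ⟨x, hx, hxg⟩ := key g
  obtain ⟨y, hy, hyh⟩ := key h
  obtain ⟨e, -, hex, hey⟩ := hA x y hx hy (eq_of_forall_characterSpace fun χ => by
    rw [map_mul, hxg, hyh, map_zero, mul_eq_zero, Complex.ofReal_eq_zero, Complex.ofReal_eq_zero,
      sq_eq_zero_iff, sq_eq_zero_iff]
    by_contra! hne
    exact Set.disjoint_left.1 hd hne.1 hne.2)
  have he : Continuous fun χ : characterSpace ℂ A => χ e :=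
    (gelfandStarTransform A e).continuous
  have h1 : closure (Function.support g) ⊆ {χ | χ e = 1} := by
    refine closure_minimal (fun χ hχ => ?_) (isClosed_eq he continuous_const)
    have h' : χ e * χ x = χ x := by rw [← map_mul, hex]
    refine mul_right_cancel₀ (b := χ x) ?_ (h'.trans (one_mul _).symm)
    rw [hxg]
    exact_mod_cast pow_ne_zero 2 hχ
  have h2 : closure (Function.support h) ⊆ {χ | χ e = 0} := by
    refine closure_minimal (fun χ hχ => ?_) (isClosed_eq he continuous_const)
    have h' : χ e * χ y = 0 := by rw [← map_mul, hey, map_zero]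
    refine (mul_eq_zero.1 h').resolve_right ?_
    rw [hyh]
    exact_mod_cast pow_ne_zero 2 hχ
  refine Set.disjoint_left.2 fun χ hg hh => ?_
  exact one_ne_zero ((h1 hg).symm.trans (h2 hh))

/-- Finitely many clopen sets in the character space generate a finite clopen partition, given by
projections of the algebra. -/
theorem exists_isStarProjection_partition {ι : Type*} [Finite ι]
    {U : ι → Set (characterSpace ℂ A)} (hU : ∀ k, IsClopen (U k)) :
    ∃ (s : ℕ) (p : Fin s → A) (S : Fin s → Set (characterSpace ℂ A)),
      (∀ i, IsStarProjection (p i)) ∧ ∑ i, p i = 1 ∧ (∀ i, ∀ χ ∈ S i, χ (p i) = 1) ∧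
      (∀ i, ∀ χ ∉ S i, χ (p i) = 0) ∧ ∀ i k, ∀ χ ∈ S i, χ ∈ U k → S i ⊆ U k := by
  classical
  have := Fintype.ofFinite ι
  -- The atoms of the Boolean algebra generated by the `U k`; some may be empty and then give the
  -- projection 0.
  let T : Set ι → Set (characterSpace ℂ A) := fun τ => {χ | τ = {k | χ ∈ U k}}
  have hT : ∀ τ, IsClopen (T τ) := fun τ => by
    have : T τ = ⋂ k, if k ∈ τ then U k else (U k)ᶜ := by
      ext χ
      simp only [T, mem_ofPred_eq, mem_iInter, Set.ext_iff]
      refine forall_congr' fun k => ?_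
      split_ifs with h <;> simp [h]
    rw [this]
    refine isClopen_iInter_of_finite fun k => ?_
    split_ifs
    exacts [hU k, (hU k).compl]
  choose P hP using fun τ => exists_forall_characterSpace_apply_eq
    ⟨(T τ).indicator (1 : characterSpace ℂ A → ℂ), (hT τ).continuous_indicator continuous_one⟩
  simp only [ContinuousMap.coe_mk] at hP
  let e := Fintype.equivFin (Set ι)
  refine ⟨_, fun i => P (e.symm i), fun i => T (e.symm i), fun i => ⟨?_, ?_⟩, ?_, ?_, ?_, ?_⟩
  · refine eq_of_forall_characterSpace fun χ => ?_
    rw [map_mul, hP]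
    by_cases h : χ ∈ T (e.symm i) <;> simp [h]
  · refine eq_of_forall_characterSpace fun χ => ?_
    rw [map_star, hP]
    by_cases h : χ ∈ T (e.symm i) <;> simp [h]
  · rw [Equiv.sum_comp e.symm P]
    refine eq_of_forall_characterSpace fun χ => ?_
    rw [map_sum, map_one]
    simp only [hP, indicator_apply, T, mem_ofPred_eq, Pi.one_apply]
    simp
  · intro i χ h
    simp [hP, h]
  · intro i χ h
    simp [hP, h]
  · intro i k χ h hk χ' h'
    have : {k | χ ∈ U k} = {k | χ' ∈ U k} := h.symm.trans h'
    exact (Set.ext_iff.1 this k).1 hk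

end Gelfand

theorem exists_continuousMap_eq_one_of_isOpen {X : Type*} [TopologicalSpace X] [CompactSpace X]
    [T2Space X] {U : Set X} (hU : IsOpen U) {x : X} (hx : x ∈ U) :
    ∃ g : C(X, ℂ), g x = 1 ∧ ∀ z ∉ U, g z = 0 := by
  obtain ⟨g, h0, h1, -⟩ := exists_continuous_zero_one_of_isClosed hU.isClosed_compl
    (isClosed_singleton (x := x)) (by simpa using hx)
  have h1 : g x = 1 := h1 rfl
  exact ⟨⟨fun z => (g z : ℂ), by fun_prop⟩, by simp [h1], fun z hz => by simp [h0 hz]⟩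

/-! ### The character space of a completed tensor product -/

section TensorProduct

variable {B C : Type*} [CommCStarAlgebra B] [CommCStarAlgebra C] (ν : CStarNorm (B ⊗[ℂ] C))

namespace CStarNorm

/-- The ⋆-homomorphism `b ↦ b ⊗ 1` into the completed tensor product. -/
noncomputable def inclLeft : B →⋆ₐ[ℂ] ν.Completion :=
  ν.toCompletion.comp
    { (Algebra.TensorProduct.includeLeft : B →ₐ[ℂ] B ⊗[ℂ] C) with
      map_star' := fun b => by simp [TensorProduct.star_tmul] }

/-- The ⋆-homomorphism `c ↦ 1 ⊗ c` into the completed tensor product. -/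
noncomputable def inclRight : C →⋆ₐ[ℂ] ν.Completion :=
  ν.toCompletion.comp
    { (Algebra.TensorProduct.includeRight : C →ₐ[ℂ] B ⊗[ℂ] C) with
      map_star' := fun b => by simp [TensorProduct.star_tmul] }

theorem toCompletion_tmul (b : B) (c : C) :
    ν.toCompletion (b ⊗ₜ c) = ν.inclLeft b * ν.inclRight c := by
  change _ = ν.toCompletion (b ⊗ₜ 1) * ν.toCompletion (1 ⊗ₜ c)
  rw [← map_mul, Algebra.TensorProduct.tmul_mul_tmul, mul_one, one_mul]

theorem toCompletion_injective : Function.Injective ν.toCompletion := fun _ _ h =>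
  UniformSpace.Completion.coe_injective ν.Carrier h

/-- Restriction of characters of a completed tensor product to the two factors. -/
noncomputable def restrict :
    C(characterSpace ℂ ν.Completion, characterSpace ℂ B × characterSpace ℂ C) :=
  (CharacterSpace.compContinuousMap ν.inclLeft).prodMk
    (CharacterSpace.compContinuousMap ν.inclRight)

theorem apply_toCompletion_tmul (χ : characterSpace ℂ ν.Completion) (b : B) (c : C) :
    χ (ν.toCompletion (b ⊗ₜ c)) = (ν.restrict χ).1 b * (ν.restrict χ).2 c := by
  rw [toCompletion_tmul, map_mul]
  rfl

theorem restrict_injective : Function.Injective ν.restrict := by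
  intro χ χ' h
  have h1 : ∀ x : B ⊗[ℂ] C, χ (ν.toCompletion x) = χ' (ν.toCompletion x) := fun x => by
    induction x using TensorProduct.induction_on with
    | zero => simp
    | tmul b c => rw [apply_toCompletion_tmul, apply_toCompletion_tmul, h]
    | add x y hx hy => rw [map_add, map_add, map_add, hx, hy]
  refine CharacterSpace.ext fun x => ?_
  induction x using UniformSpace.Completion.induction_on with
  | hp => exact isClosed_eq (map_continuous χ) (map_continuous χ')
  | ih x => exact h1 x

/-- A missed open box would carry bump functions `b`, `c` such that every character kills `b ⊗ c`.
Since `ν` is a norm, not just a seminorm, `b ⊗ c` vanishes already in the algebraic tensor product.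
-/
theorem restrict_surjective : Function.Surjective ν.restrict := by
  rintro ⟨x, y⟩
  by_contra hxy
  have ho : IsOpen (range ν.restrict)ᶜ :=
    (isCompact_range ν.restrict.continuous).isClosed.isOpen_compl
  obtain ⟨U, V, hU, hV, hx, hy, hUV⟩ := isOpen_prod_iff.1 ho x y hxy
  obtain ⟨g, hg1, hg0⟩ := exists_continuousMap_eq_one_of_isOpen hU hx
  obtain ⟨h, hh1, hh0⟩ := exists_continuousMap_eq_one_of_isOpen hV hy
  obtain ⟨b, hb⟩ := exists_forall_characterSpace_apply_eq g
  obtain ⟨c, hc⟩ := exists_forall_characterSpace_apply_eq h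
  have hz : b ⊗ₜ[ℂ] c = 0 := by
    refine ν.toCompletion_injective (eq_of_forall_characterSpace fun χ => ?_)
    rw [apply_toCompletion_tmul, hb, hc, map_zero, map_zero, mul_eq_zero]
    by_contra! hne
    exact hUV (mk_mem_prod (not_imp_comm.1 (hg0 _) hne.1) (not_imp_comm.1 (hh0 _) hne.2))
      (mem_range_self χ)
  -- The functional `x ⊗ y` lives on the algebraic tensor product, so no continuity is needed; it
  -- takes the value 1 on `b ⊗ c`.
  have hz' := congrArg (fun t => y (TensorProduct.lid ℂ C
    (LinearMap.rTensor C (CharacterSpace.toAlgHom x).toLinearMap t))) hz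
  simp [hb, hc, hg1, hh1] at hz'

/-- The character space of a completed tensor product is the product of the character spaces. -/
noncomputable def restrictHomeomorph :
    characterSpace ℂ ν.Completion ≃ₜ characterSpace ℂ B × characterSpace ℂ C :=
  Continuous.homeoOfEquivCompactToT2
    (f := Equiv.ofBijective _ ⟨ν.restrict_injective, ν.restrict_surjective⟩)
    ν.restrict.continuous

theorem apply_eq_restrictHomeomorph_symm (χ : characterSpace ℂ ν.Completion) :
    ν.restrictHomeomorph.symm (ν.restrict χ) = χ :=
  ν.restrictHomeomorph.symm_apply_apply χ

theorem toCompletion_mul_eq_iff {b b' : B} {c c' : C} {d : ν.Completion} :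
    ν.toCompletion (b ⊗ₜ c) * d = ν.toCompletion (b' ⊗ₜ c') ↔
      ∀ χ, (ν.restrict χ).1 b * (ν.restrict χ).2 c * χ d =
        (ν.restrict χ).1 b' * (ν.restrict χ).2 c' := by
  simp only [← apply_toCompletion_tmul]
  refine ⟨fun h χ => ?_, fun h => eq_of_forall_characterSpace fun χ => ?_⟩
  · rw [← h]
    exact (map_mul χ _ _).symm
  · exact (map_mul χ _ _).trans (h χ)

end CStarNorm

end TensorProduct

/-! ### Assembling the projections -/

theorem mainTheorem3
    {A B C : Type*} [CommCStarAlgebra A] [PartialOrder A] [StarOrderedRing A]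
    [CommCStarAlgebra B] [CommCStarAlgebra C]
    (hA : IsSAWStarAlgebra A)
    (ν : CStarNorm (B ⊗[ℂ] C)) (f : A →⋆ₐ[ℂ] ν.Completion) :
    ∃ (s t : ℕ) (p : Fin s → B) (q : Fin t → C),
      (∀ i, IsStarProjection (p i)) ∧ (∀ j, IsStarProjection (q j)) ∧
      ∑ i, p i = 1 ∧ ∑ j, q j = 1 ∧
      ∀ (i : Fin s) (j : Fin t),
        (∀ a : A, ∃ b : B, ν.toCompletion (p i ⊗ₜ[ℂ] q j) * f a =
          ν.toCompletion ((p i * b * p i) ⊗ₜ[ℂ] q j)) ∨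
        (∀ a : A, ∃ c : C, ν.toCompletion (p i ⊗ₜ[ℂ] q j) * f a =
          ν.toCompletion (p i ⊗ₜ[ℂ] (q j * c * q j))) := by
  let φ : characterSpace ℂ B × characterSpace ℂ C → characterSpace ℂ A := fun z =>
    CharacterSpace.compContinuousMap f (ν.restrictHomeomorph.symm z)
  have hφ : Continuous φ :=
    (CharacterSpace.compContinuousMap f).continuous.comp ν.restrictHomeomorph.symm.continuous
  have hφa : ∀ (χ : characterSpace ℂ ν.Completion) (a : A), χ (f a) = φ (ν.restrict χ) a := by
    intro χ a
    simp only [φ, ν.apply_eq_restrictHomeomorph_symm]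
    rfl
  clear_value φ
  have hca : ∀ a : A, Continuous fun z => φ z a := fun a =>
    (gelfandStarTransform A a).continuous.comp hφ
  choose U V hU hV hxU hyV hUV using fun z : characterSpace ℂ B × characterSpace ℂ C =>
    hA.isFSpace.exists_isClopen_prod hφ z.1 z.2
  obtain ⟨T, -, hT⟩ := isCompact_univ.elim_nhds_subcover (fun z => U z ×ˢ V z) fun z _ =>
    ((hU z).isOpen.prod (hV z).isOpen).mem_nhds ⟨hxU z, hyV z⟩
  obtain ⟨s, p, S, hp, hp1, hpS, hpS', hSU⟩ :=
    exists_isStarProjection_partition fun k : T => hU k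
  obtain ⟨t, q, R, hq, hq1, hqR, hqR', hRV⟩ :=
    exists_isStarProjection_partition fun k : T => hV k
  refine ⟨s, t, p, q, hp, hq, hp1, hq1, fun i j => ?_⟩
  rcases (S i).eq_empty_or_nonempty with hS | ⟨x, hx⟩
  · have : p i = 0 := eq_of_forall_characterSpace fun χ => by
      rw [hpS' i χ (by simp [hS]), map_zero]
    exact Or.inl fun a => ⟨0, by simp [this]⟩
  rcases (R j).eq_empty_or_nonempty with hR | ⟨y, hy⟩
  · have : q j = 0 := eq_of_forall_characterSpace fun χ => by
      rw [hqR' j χ (by simp [hR]), map_zero]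
    exact Or.inl fun a => ⟨0, by simp [this]⟩
  obtain ⟨k, hk, hxk, hyk⟩ := mem_iUnion₂.1 (hT (mem_univ (x, y)))
  have hSk := hSU i ⟨k, hk⟩ x hx hxk
  have hRk := hRV j ⟨k, hk⟩ y hy hyk
  rcases hUV k with h | h
  · refine Or.inr fun a => ?_
    -- On this rectangle `φ` ignores the first coordinate, so its slice at `x` represents `f a`
    -- there; off the rectangle `p i ⊗ q j` vanishes.
    obtain ⟨d, hd⟩ := exists_forall_characterSpace_apply_eq ⟨fun y' => φ (x, y') a,
      (hca a).comp (by fun_prop : Continuous fun y' => (x, y'))⟩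
    refine ⟨d, ν.toCompletion_mul_eq_iff.2 fun χ => ?_⟩
    rw [hφa]
    obtain ⟨u, v⟩ := ν.restrict χ
    simp only [map_mul, hd, ContinuousMap.coe_mk]
    by_cases h1 : u ∈ S i
    · by_cases h2 : v ∈ R j
      · simp [hpS _ _ h1, hqR _ _ h2, h x (hSk hx) _ (hSk h1) _ (hRk h2)]
      · simp [hqR' _ _ h2]
    · simp [hpS' _ _ h1]
  · refine Or.inl fun a => ?_
    obtain ⟨d, hd⟩ := exists_forall_characterSpace_apply_eq ⟨fun x' => φ (x', y) a,
      (hca a).comp (by fun_prop : Continuous fun x' => (x', y))⟩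
    refine ⟨d, ν.toCompletion_mul_eq_iff.2 fun χ => ?_⟩
    rw [hφa]
    obtain ⟨u, v⟩ := ν.restrict χ
    simp only [map_mul, hd, ContinuousMap.coe_mk]
    by_cases h1 : u ∈ S i
    · by_cases h2 : v ∈ R j
      · simp [hpS _ _ h1, hqR _ _ h2, h _ (hSk h1) y (hRk hy) _ (hRk h2)]
      · simp [hqR' _ _ h2]
    · simp [hpS' _ _ h1]
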